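/- Let $\lambda\in(0,\infty)$ and $a\in(0,1]$, and for integers $n\ge\lambda$ let $G_n$ be the Erdős–Rényi random graph on $n$ labelled vertices in which each edge is present independently with probability $p_n=\lambda/n$. Let $V_T(G_n)$ be the number of vertices of $G_n$ that lie in at least one triangle, and let $\mathrm{DT}_n(G_n)$ be the maximum number of vertex-disjoint triangles in $G_n$. Then there is a constant $C=C(\lambda,a)$, independent of $\varepsilon$ and $n$, such that for every $\varepsilon>0$ and every integer $n\ge\max(3,\lambda)$, $$\mathbb{P}\Big(\mathrm{DT}_n(G_n)\le \tfrac13(a-\varepsilon)n \,\Big|\, V_T(G_n)\ge an\Big)\le \exp\Big(-\tfrac16\,\varepsilon\, n\log n + Cn\Big).$$ In particular, for every $\varepsilon>0$, $$\lim_{n\to\infty}\mathbb{P}\Big(\mathrm{DT}_n(G_n)\ge \tfrac13(a-\varepsilon)n \,\Big|\, V_T(G_n)\ge an\Big)=1 .$$ -/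

import Mathlib

open MeasureTheory ProbabilityTheory Filter Topology

namespace RandomTriangles

/-- The number of vertices of `G` that lie in at least one triangle of `G`. -/
noncomputable def verticesInTriangles {V : Type*} [Fintype V] (G : SimpleGraph V) : ℕ :=
  {v : V | ∃ t : Finset V, G.IsNClique 3 t ∧ v ∈ t}.ncard

/-- A family of triangles of `G`, given by their vertex sets, no two of which share a vertex. -/
def IsDisjointTriangleFamily {V : Type*} (G : SimpleGraph V) (T : Finset (Finset V)) : Prop :=
  (∀ t ∈ T, G.IsNClique 3 t) ∧ (T : Set (Finset V)).PairwiseDisjoint id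

open Classical in
/-- The maximum number of vertex-disjoint triangles in `G`. -/
noncomputable def maxDisjointTriangles {V : Type*} [Fintype V] (G : SimpleGraph V) : ℕ :=
  (Finset.univ.filter (IsDisjointTriangleFamily G)).sup Finset.card

/-- The supremum in `maxDisjointTriangles` is attained. -/
theorem isGreatest_maxDisjointTriangles {V : Type*} [Fintype V] (G : SimpleGraph V) :
    IsGreatest {k : ℕ | ∃ T : Finset (Finset V), IsDisjointTriangleFamily G T ∧ T.card = k}
      (maxDisjointTriangles G) := by
  classical
  constructor
  · have hne : (Finset.univ.filter (IsDisjointTriangleFamily G)).Nonempty :=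
      ⟨∅, by simp [IsDisjointTriangleFamily]⟩
    obtain ⟨T, hT, h⟩ := Finset.exists_mem_eq_sup _ hne Finset.card
    refine ⟨T, (Finset.mem_filter.mp hT).2, ?_⟩
    rw [maxDisjointTriangles, ← h]
  · rintro k ⟨T, hT, rfl⟩
    unfold maxDisjointTriangles
    exact Finset.le_sup (f := Finset.card) (Finset.mem_filter.mpr ⟨Finset.mem_univ _, hT⟩)

/-- The edge probability `lam / n`, truncated to `[0, 1]` (the truncation plays no role once
`lam ≤ n`, see `coe_edgeProb`). -/
noncomputable def edgeProb (lam : ℝ) (n : ℕ) : unitInterval :=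
  Set.projIcc 0 1 zero_le_one (lam / n)

theorem coe_edgeProb {lam : ℝ} {n : ℕ} (h0 : 0 < lam) (hn : lam ≤ n) :
    (edgeProb lam n : ℝ) = lam / n := by
  have h : lam / n ∈ Set.Icc (0 : ℝ) 1 :=
    ⟨by positivity, div_le_one_of_le₀ hn (Nat.cast_nonneg n)⟩
  rw [edgeProb, Set.projIcc_of_mem zero_le_one h]

/-- The law of the Erdős–Rényi random graph on `n` labelled vertices with edge probability
`lam / n`. -/
noncomputable def erdosRenyi (lam : ℝ) (n : ℕ) : Measure (SimpleGraph (Fin n)) :=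
  SimpleGraph.binomialRandom (Fin n) (edgeProb lam n)

/-- The law of the Erdős–Rényi random graph conditioned on having at least `a * n` vertices in
triangles. -/
noncomputable def conditionedLaw (lam a : ℝ) (n : ℕ) : Measure (SimpleGraph (Fin n)) :=
  ProbabilityTheory.cond (erdosRenyi lam n)
    {G | a * (n : ℝ) ≤ (verticesInTriangles G : ℝ)}

end RandomTriangles

namespace RandomTriangles

/-! Cover the triangle vertices greedily: while one lies outside the covered set `U`, add a triangle
through it. A step adds three vertices only if its triangle is disjoint from `U`, and such triangles
form a disjoint family, so `V_T ≤ 2 * steps + DT`. Hence `V_T ≥ an` and `DT ≤ (a - ε)n/3` force at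
least `(a/3 + ε/6)n` steps.

Each step costs `O(1/n)` per vertex: either three new edges and two free vertices (`n²p³`), or two
new edges and a pointer to an edge already recorded (`9np²`). A union bound over the codes of the
steps, with weight `n` per step, bounds the joint event by `n^(-(a/3 + ε/6)n) e^(O(n))`
(`exists_code`, `binomialRandom_real_le`).

Conversely, planting about `an/3` triangles along two permutations gives `((an/3)!)²` graphs, up to
rounding, with about `an` edges each, so the conditioning event has probability at least `n^(-an/3)
e^(-O(n))` (`le_binomialRandom_real`). The quotient leaves `n^(-εn/6) e^(O(n))`. -/

/-! ### Edge sets and single graphs in the binomial model -/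

instance measurableSingletonClass_simpleGraph {V : Type*} [Countable V] :
    MeasurableSingletonClass (SimpleGraph V) where
  measurableSet_singleton G := by
    have h : ({G} : Set (SimpleGraph V)) = SimpleGraph.Adj ⁻¹' {G.Adj} := by
      ext H
      simp [SimpleGraph.adj_inj]
    rw [h]
    exact SimpleGraph.measurable_adj (measurableSet_singleton _)

/-- The probability that a binomial random graph contains a prescribed set of edges. -/
theorem binomialRandom_real_superset_le {V : Type*} [Finite V] (p : unitInterval)
    (M : Finset (Sym2 V)) :
    (SimpleGraph.binomialRandom V p).real {G | (M : Set (Sym2 V)) ⊆ G.edgeSet}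
      ≤ (p : ℝ) ^ M.card := by
  classical
  cases nonempty_fintype V
  have hsub : SimpleGraph.edgeSet '' {G : SimpleGraph V | (M : Set (Sym2 V)) ⊆ G.edgeSet}
      ⊆ {S | (M : Set (Sym2 V)) ⊆ S} := by
    rintro _ ⟨G, hG, rfl⟩
    exact hG
  have hpi : (fun q : Sym2 V → Prop ↦ {e | q e}) ⁻¹' {S : Set (Sym2 V) | (M : Set (Sym2 V)) ⊆ S}
      = Set.pi (M : Set (Sym2 V)) (fun _ ↦ {True}) := by
    ext q
    simp [Set.subset_def, Set.mem_pi]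
  have hle : SimpleGraph.binomialRandom V p {G | (M : Set (Sym2 V)) ⊆ G.edgeSet}
      ≤ (unitInterval.toNNReal p : ENNReal) ^ M.card := by
    rw [SimpleGraph.binomialRandom_apply']
    refine (measure_mono hsub).trans ?_
    rw [setBernoulli_apply', hpi, Measure.infinitePi_pi]
    · rw [← Finset.prod_const]
      refine Finset.prod_le_prod' fun e _ ↦ ?_
      by_cases he : e ∈ (Sym2.diagSet : Set (Sym2 V))ᶜ
      · simp [he]
      · simp [he]
    · intro i _
      trivial
  rw [measureReal_def]
  refine (ENNReal.toReal_mono (by simp) hle).trans ?_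
  simp

theorem binomialRandom_real_singleton {V : Type*} [Finite V] (p : unitInterval)
    (G : SimpleGraph V) :
    (SimpleGraph.binomialRandom V p).real {G} = (p : ℝ) ^ G.edgeSet.ncard *
      (1 - p : ℝ) ^ ((Nat.card V).choose 2 - G.edgeSet.ncard) := by
  simp [measureReal_def]

/-- Sum over singletons; `|V|²` is a crude bound for the number of non-edges. -/
theorem card_mul_le_binomialRandom_real {V : Type*} [Finite V] (p : unitInterval)
    (S : Finset (SimpleGraph V)) (e : ℕ) (hS : ∀ G ∈ S, G.edgeSet.ncard ≤ e) :
    (S.card : ℝ) * ((p : ℝ) ^ e * (1 - p : ℝ) ^ (Nat.card V ^ 2))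
      ≤ (SimpleGraph.binomialRandom V p).real S := by
  classical
  cases nonempty_fintype V
  rw [← nsmul_eq_mul, ← Finset.sum_const, ← sum_measureReal_singleton]
  refine Finset.sum_le_sum fun G hG ↦ ?_
  rw [binomialRandom_real_singleton]
  have hp0 := p.2.1
  have hp1 := p.2.2
  have hq : Nat.card V ^ 2 ≥ (Nat.card V).choose 2 - G.edgeSet.ncard :=
    (Nat.sub_le _ _).trans (Nat.choose_le_pow _ _)
  refine mul_le_mul (pow_le_pow_of_le_one hp0 hp1 (hS G hG))
    (pow_le_pow_of_le_one (by linarith) (by linarith) hq) ?_ (by positivity)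
  exact pow_nonneg (by linarith) _

/-! ### Codes for triangle assignments -/

/-- A vertex is assigned no triangle, a triangle with two further vertices, or a triangle whose
opposite edge joins the `i`-th and `j`-th vertex of the triangle of another vertex. -/
abbrev TriangleCode (V : Type*) : Type _ := Option ((V × V) ⊕ (V × Fin 3 × Fin 3))

namespace TriangleCode
variable {V : Type*}

/-- The vertices of the triangle assigned to `x`, given the triangles of the other vertices. -/
def vertices (tri : V → Fin 3 → V) (x : V) : TriangleCode V → Fin 3 → V
  | none => fun _ ↦ x
  | some (.inl (y, z)) => ![x, y, z]
  | some (.inr (w, i, j)) => ![x, tri w i, tri w j]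

/-- The number of edges contributed by a code. -/
def weight : TriangleCode V → ℕ
  | none => 0
  | some (.inl _) => 3
  | some (.inr _) => 2

/-- `1` for a vertex with a triangle, `0` otherwise. -/
def leader : TriangleCode V → ℕ
  | none => 0
  | some _ => 1

/-- `tri` is a solution of the recursion described by the assignment `c`, which is well-founded
with rank function `r`. -/
structure Decodes (c : V → TriangleCode V) (r : V → ℕ) (tri : V → Fin 3 → V) : Prop where
  eq : ∀ x, tri x = vertices tri x (c x)
  rank : ∀ x w i j, c x = some (.inr (w, i, j)) → r w < r x

/-- Induction on rank: pointers lead to smaller rank. The code alone thus fixes the triangles,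
whichever rank function witnesses well-foundedness. -/
theorem Decodes.unique {c : V → TriangleCode V} {r r' : V → ℕ} {tri tri' : V → Fin 3 → V}
    (h : Decodes c r tri) (h' : Decodes c r' tri') : tri = tri' := by
  have key : ∀ n x, r x = n → tri x = tri' x := by
    intro n
    induction n using Nat.strong_induction_on with
    | _ n ih =>
      intro x hx
      rw [h.eq x, h'.eq x]
      rcases hc : c x with _ | ⟨y, z⟩ | ⟨w, i, j⟩
      · rfl
      · rfl
      · have := ih (r w) (hx ▸ h.rank x w i j hc) w rfl
        simp [vertices, this]
  exact funext fun x ↦ key _ x rfl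

variable [Fintype V]

open Classical in
/-- All edges of the triangles of a triangle assignment. -/
noncomputable def edges (tri : V → Fin 3 → V) : Finset (Sym2 V) :=
  {e | ¬ e.IsDiag ∧ ∃ x i j, e = s(tri x i, tri x j)}

theorem mem_edges {tri : V → Fin 3 → V} {e : Sym2 V} :
    e ∈ edges tri ↔ ¬ e.IsDiag ∧ ∃ x i j, e = s(tri x i, tri x j) := by
  simp [edges]

theorem sum_update [DecidableEq V] (f : TriangleCode V → ℕ) (hf : f none = 0)
    (c : V → TriangleCode V) {v : V} (hv : c v = none) (k : TriangleCode V) :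
    ∑ x, f (Function.update c v k x) = ∑ x, f (c x) + f k := by
  rw [← Finset.add_sum_erase _ (fun x ↦ f (Function.update c v k x)) (Finset.mem_univ v),
    ← Finset.add_sum_erase _ (fun x ↦ f (c x)) (Finset.mem_univ v), hv, hf, zero_add,
    Function.update_self, add_comm]
  congr 1
  refine Finset.sum_congr rfl fun x hx ↦ ?_
  rw [Function.update_of_ne (Finset.ne_of_mem_erase hx)]

end TriangleCode

open TriangleCode

variable {V : Type*} [Fintype V]

/-! ### Greedy triangle covers -/

/-- A set `U` of vertices covered by triangles of `G` which are recorded in the code `c`; the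
triangles in `T` are pairwise disjoint, and every other triangle contributes at most two vertices
to `U`. -/
structure IsTriangleCover (G : SimpleGraph V) (U : Finset V) (c : V → TriangleCode V)
    (r : V → ℕ) (tri : V → Fin 3 → V) (T : Finset (Finset V)) : Prop where
  decodes : Decodes c r tri
  rank_le : ∀ x, r x ≤ U.card
  pointer_mem : ∀ x w i j, c x = some (.inr (w, i, j)) → w ∈ U
  leader_mem : ∀ x, c x ≠ none → x ∈ U
  edge_mem : ∀ e ∈ edges tri, e ∈ G.edgeSet
  edge_subset : ∀ e ∈ edges tri, ∀ v ∈ e, v ∈ U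
  sum_weight_le : ∑ x, weight (c x) ≤ (edges tri).card
  family : IsDisjointTriangleFamily G T
  family_subset : ∀ t ∈ T, t ⊆ U
  card_le : U.card ≤ 2 * ∑ x, leader (c x) + T.card

theorem isTriangleCover_empty (G : SimpleGraph V) :
    IsTriangleCover G ∅ (fun _ ↦ none) (fun _ ↦ 0) (fun x _ ↦ x) ∅ := by
  have h : edges (fun (x : V) (_ : Fin 3) ↦ x) = ∅ := by
    ext e
    simp only [mem_edges, Finset.notMem_empty, iff_false, not_and, not_exists]
    rintro he x - - rfl
    exact he rfl
  refine ⟨⟨fun _ ↦ rfl, by simp⟩, by simp, by simp, by simp, by simp [h], by simp [h],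
    by simp [weight], ⟨by simp, by simp⟩, by simp, by simp⟩

/-- The greedy step. Recorded edges stay inside `U`, so both edges at `v` are new, and only `yz` may
already be recorded; in that case the code points to it. -/
theorem IsTriangleCover.extend [DecidableEq V] {G : SimpleGraph V} {U : Finset V}
    {c : V → TriangleCode V} {r : V → ℕ} {tri : V → Fin 3 → V} {T : Finset (Finset V)}
    (h : IsTriangleCover G U c r tri T) {v y z : V} (hvy : G.Adj v y) (hvz : G.Adj v z)
    (hyz : G.Adj y z) (hv : v ∉ U) :
    ∃ U' c' r' tri' T', IsTriangleCover G U' c' r' tri' T' ∧ U.card < U'.card := by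
  have hcv : c v = none := by
    by_contra hne
    exact hv (h.leader_mem v hne)
  obtain ⟨k, hk0, hkv, hkp, hkw⟩ : ∃ k : TriangleCode V, leader k = 1 ∧
      (vertices tri v k = ![v, y, z]) ∧
      (∀ w i j, k = some (.inr (w, i, j)) → w ∈ U) ∧
      (weight k ≤ 2 ∨ weight k ≤ 3 ∧ s(y, z) ∉ edges tri) := by
    by_cases he : s(y, z) ∈ edges tri
    · obtain ⟨-, w, i, j, hw⟩ := mem_edges.1 he
      have hwU : w ∈ U := by
        apply h.leader_mem
        -- Without a triangle at `w`, its triple would be constant and `yz` a loop.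
        intro hn
        have h1 := h.decodes.eq w
        rw [hn] at h1
        rw [h1] at hw
        simp only [vertices, Sym2.eq_iff] at hw
        apply hyz.ne
        grind
      rcases Sym2.eq_iff.1 hw with ⟨h1, h2⟩ | ⟨h1, h2⟩
      · exact ⟨some (.inr (w, i, j)), rfl, by simp [vertices, ← h1, ← h2], by simp +contextual [hwU],
          Or.inl le_rfl⟩
      · exact ⟨some (.inr (w, j, i)), rfl, by simp [vertices, ← h1, ← h2], by simp +contextual [hwU],
          Or.inl le_rfl⟩
    · exact ⟨some (.inl (y, z)), rfl, rfl, by simp, Or.inr ⟨le_rfl, he⟩⟩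
  have htv : tri v = fun _ ↦ v := by rw [h.decodes.eq v, hcv]; rfl
  set tri' := Function.update tri v ![v, y, z] with htri'
  set c' := Function.update c v k with hc'
  -- Old ranks are at most `U.card`, so this exceeds the rank of every possible pointer target.
  set r' := Function.update r v (U.card + 1) with hr'
  have hUv : U.card + 1 = (insert v U).card := (Finset.card_insert_of_notMem hv).symm
  have hlt : U.card + 1 ≤ (U ∪ {v, y, z}).card := by
    rw [hUv]
    apply Finset.card_le_card
    intro x
    simp only [Finset.mem_insert, Finset.mem_union, Finset.mem_singleton]
    tauto
  have hdec : Decodes c' r' tri' := by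
    constructor
    · intro x
      by_cases hx : x = v
      · subst hx
        rw [htri', hc', Function.update_self, Function.update_self, ← hkv]
        rcases k with _ | ⟨a, b⟩ | ⟨w, i, j⟩
        · rfl
        · rfl
        -- Pointers lead into `U`, so changing the triangle at the new vertex affects no decoded
        -- pointer.
        · have hw : w ≠ x := fun hw ↦ hv (hw ▸ hkp w i j rfl)
          simp [vertices, Function.update_of_ne hw]
      · rw [htri', hc', Function.update_of_ne hx, Function.update_of_ne hx]
        rw [h.decodes.eq x]
        rcases hcx : c x with _ | ⟨a, b⟩ | ⟨w, i, j⟩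
        · rfl
        · rfl
        · have hw : w ≠ v := fun hw ↦ hv (hw ▸ h.pointer_mem x w i j hcx)
          simp [vertices, Function.update_of_ne hw]
    · intro x w i j hx
      by_cases hxv : x = v
      · subst hxv
        rw [hc', Function.update_self] at hx
        have hw : w ≠ x := fun hw ↦ hv (hw ▸ hkp w i j hx)
        rw [hr', Function.update_self, Function.update_of_ne hw]
        exact Nat.lt_succ_of_le (h.rank_le w)
      · rw [hc', Function.update_of_ne hxv] at hx
        have hw : w ≠ v := fun hw ↦ hv (hw ▸ h.pointer_mem x w i j hx)
        rw [hr', Function.update_of_ne hxv, Function.update_of_ne hw]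
        exact h.decodes.rank x w i j hx
  have hedges : ∀ e, e ∈ edges tri' ↔ e ∈ edges tri ∨ e = s(v, y) ∨ e = s(v, z) ∨ e = s(y, z) := by
    intro e
    constructor
    · intro he
      obtain ⟨hd, x, i, j, rfl⟩ := mem_edges.1 he
      by_cases hx : x = v
      · subst hx
        right
        rw [htri', Function.update_self] at hd ⊢
        fin_cases i <;> fin_cases j <;> simp at hd ⊢
      · left
        rw [htri', Function.update_of_ne hx] at hd ⊢
        exact mem_edges.2 ⟨hd, x, i, j, rfl⟩
    · rintro (he | rfl | rfl | rfl)
      · obtain ⟨hd, x, i, j, rfl⟩ := mem_edges.1 he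
        have hx : x ≠ v := by
          rintro rfl
          rw [htv] at hd
          exact hd rfl
        exact mem_edges.2 ⟨hd, x, i, j, by rw [htri', Function.update_of_ne hx]⟩
      · exact mem_edges.2 ⟨by simpa using hvy.ne, v, 0, 1, by simp [htri']⟩
      · exact mem_edges.2 ⟨by simpa using hvz.ne, v, 0, 2, by simp [htri']⟩
      · exact mem_edges.2 ⟨by simpa using hyz.ne, v, 1, 2, by simp [htri']⟩
  have hnew : ∀ w, s(v, w) ∉ edges tri := fun w hw ↦ hv (h.edge_subset _ hw v (by simp))
  have hne : s(v, y) ≠ s(v, z) := by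
    intro hh
    rcases Sym2.eq_iff.1 hh with ⟨-, h2⟩ | ⟨h1, h2⟩
    · exact hyz.ne h2
    · exact hvz.ne h1
  have hweight : ∑ x, weight (c' x) ≤ (edges tri').card := by
    rw [hc', sum_update weight rfl c hcv]
    have h2 : (insert s(v, y) (insert s(v, z) (edges tri))).card = (edges tri).card + 2 := by
      rw [Finset.card_insert_of_notMem, Finset.card_insert_of_notMem (hnew z)]
      simp [hne, hnew y]
    have hss : insert s(v, y) (insert s(v, z) (edges tri)) ⊆ edges tri' := by
      intro e he
      rw [hedges]
      simp only [Finset.mem_insert] at he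
      tauto
    rcases hkw with hkw | ⟨hkw, hyzn⟩
    · have := Finset.card_le_card hss
      have := h.sum_weight_le
      omega
    · have h3 : s(y, z) ∉ insert s(v, y) (insert s(v, z) (edges tri)) := by
        simp only [Finset.mem_insert, not_or]
        refine ⟨?_, ?_, hyzn⟩
        · intro hh
          rcases Sym2.eq_iff.1 hh with ⟨h1, -⟩ | ⟨-, h2⟩
          · exact hvy.ne h1.symm
          · exact hvz.ne h2.symm
        · intro hh
          rcases Sym2.eq_iff.1 hh with ⟨h1, -⟩ | ⟨-, h2⟩
          · exact hvy.ne h1.symm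
          · exact hvz.ne h2.symm
      have hss3 : insert s(y, z) (insert s(v, y) (insert s(v, z) (edges tri))) ⊆ edges tri' := by
        refine Finset.insert_subset ?_ hss
        rw [hedges]
        tauto
      have := Finset.card_le_card hss3
      rw [Finset.card_insert_of_notMem h3] at this
      have := h.sum_weight_le
      omega
  have hlead : ∑ x, leader (c' x) = ∑ x, leader (c x) + 1 := by
    rw [hc', sum_update leader rfl c hcv, hk0]
  have hclique : G.IsNClique 3 {v, y, z} := SimpleGraph.is3Clique_triple_iff.2 ⟨hvy, hvz, hyz⟩
  obtain ⟨T', hT', hT'U, hT'card⟩ : ∃ T' : Finset (Finset V), IsDisjointTriangleFamily G T' ∧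
      (∀ t ∈ T', t ⊆ U ∪ {v, y, z}) ∧
      (U ∪ {v, y, z}).card ≤ 2 * ∑ x, leader (c' x) + T'.card := by
    rw [hlead]
    have hcard := h.card_le
    -- At most two new vertices are paid for by the new leader; if there are three, the triangle
    -- avoids `U` and joins the disjoint family.
    by_cases hyzU : y ∈ U ∨ z ∈ U
    · refine ⟨T, h.family, fun t ht ↦ (h.family_subset t ht).trans Finset.subset_union_left, ?_⟩
      have : (U ∪ {v, y, z}).card ≤ U.card + 2 := by
        rcases hyzU with hy | hz
        · have : U ∪ {v, y, z} ⊆ insert v (insert z U) := by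
            intro x
            simp only [Finset.mem_union, Finset.mem_insert, Finset.mem_singleton]
            rintro (hx | rfl | rfl | rfl) <;> simp [*]
          refine (Finset.card_le_card this).trans ?_
          exact (Finset.card_insert_le _ _).trans (Nat.succ_le_succ (Finset.card_insert_le _ _))
        · have : U ∪ {v, y, z} ⊆ insert v (insert y U) := by
            intro x
            simp only [Finset.mem_union, Finset.mem_insert, Finset.mem_singleton]
            rintro (hx | rfl | rfl | rfl) <;> simp [*]
          refine (Finset.card_le_card this).trans ?_
          exact (Finset.card_insert_le _ _).trans (Nat.succ_le_succ (Finset.card_insert_le _ _))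
      omega
    · push Not at hyzU
      have hdisj : Disjoint U {v, y, z} := by
        rw [Finset.disjoint_right]
        simp [hv, hyzU]
      have hnot : ({v, y, z} : Finset V) ∉ T := fun ht ↦
        hv (h.family_subset _ ht (by simp))
      refine ⟨insert {v, y, z} T, ⟨?_, ?_⟩, ?_, ?_⟩
      · intro t ht
        rcases Finset.mem_insert.1 ht with rfl | ht
        · exact hclique
        · exact h.family.1 t ht
      · rw [Finset.coe_insert]
        refine h.family.2.insert fun t ht _ ↦ ?_
        exact (hdisj.mono_left (h.family_subset t ht)).symm
      · intro t ht
        rcases Finset.mem_insert.1 ht with rfl | ht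
        · exact Finset.subset_union_right
        · exact (h.family_subset t ht).trans Finset.subset_union_left
      · rw [Finset.card_union_of_disjoint hdisj, hclique.card_eq,
          Finset.card_insert_of_notMem hnot]
        omega
  refine ⟨U ∪ {v, y, z}, c', r', tri', T', ⟨hdec, ?_, ?_, ?_, ?_, ?_, hweight, hT', hT'U,
    hT'card⟩, hlt⟩
  · intro x
    by_cases hx : x = v
    · subst hx
      rwa [hr', Function.update_self]
    · rw [hr', Function.update_of_ne hx]
      exact (h.rank_le x).trans (by omega)
  · intro x w i j hx
    apply Finset.mem_union_left
    by_cases hxv : x = v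
    · subst hxv
      rw [hc', Function.update_self] at hx
      exact hkp w i j hx
    · rw [hc', Function.update_of_ne hxv] at hx
      exact h.pointer_mem x w i j hx
  · intro x hx
    by_cases hxv : x = v
    · simp [hxv]
    · rw [hc', Function.update_of_ne hxv] at hx
      exact Finset.mem_union_left _ (h.leader_mem x hx)
  · intro e he
    rcases (hedges e).1 he with he | rfl | rfl | rfl
    · exact h.edge_mem e he
    · exact hvy
    · exact hvz
    · exact hyz
  · intro e he
    rcases (hedges e).1 he with he | rfl | rfl | rfl
    · exact fun u hu ↦ Finset.mem_union_left _ (h.edge_subset e he u hu)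
    all_goals
      intro u hu
      rcases Sym2.mem_iff.1 hu with rfl | rfl <;> simp

/-- Every graph has a triangle cover of all the vertices in triangles. -/
theorem exists_isTriangleCover (G : SimpleGraph V) :
    ∃ U c r tri T, IsTriangleCover G U c r tri T ∧ verticesInTriangles G ≤ U.card := by
  classical
  -- A largest cover misses no triangle vertex, as it could otherwise be extended.
  obtain ⟨U, hU, hmax⟩ := Finset.exists_max_image
    (Finset.univ.filter fun U : Finset V ↦ ∃ c r tri T, IsTriangleCover G U c r tri T) Finset.card
    ⟨∅, by simpa using ⟨_, _, _, _, isTriangleCover_empty G⟩⟩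
  obtain ⟨c, r, tri, T, h⟩ := (Finset.mem_filter.1 hU).2
  refine ⟨U, c, r, tri, T, h, ?_⟩
  rw [verticesInTriangles, ← Set.ncard_coe_finset]
  refine Set.ncard_le_ncard ?_ (Set.toFinite _)
  rintro v ⟨t, ht, hvt⟩
  by_contra hv
  obtain ⟨y, z, hvy, hvz, hyz⟩ : ∃ y z, G.Adj v y ∧ G.Adj v z ∧ G.Adj y z := by
    obtain ⟨a, b, d, hab, had, hbd, rfl⟩ := SimpleGraph.is3Clique_iff.1 ht
    simp only [Finset.mem_insert, Finset.mem_singleton] at hvt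
    rcases hvt with rfl | rfl | rfl
    · exact ⟨b, d, hab, had, hbd⟩
    · exact ⟨a, d, hab.symm, hbd, had⟩
    · exact ⟨a, b, had.symm, hbd.symm, hab⟩
  obtain ⟨U', c', r', tri', T', h', hlt⟩ := h.extend hvy hvz hyz (by simpa using hv)
  have := hmax U' (by simpa using ⟨c', r', tri', T', h'⟩)
  omega

/-! ### Union bound over codes -/

/-- The event that `G` contains the edges of the triangles coded by `c`. -/
def codeEvent (c : V → TriangleCode V) : Set (SimpleGraph V) :=
  {G | ∃ r tri, Decodes c r tri ∧ (∀ e ∈ edges tri, e ∈ G.edgeSet) ∧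
    ∑ x, weight (c x) ≤ (edges tri).card}

theorem exists_code (G : SimpleGraph V) :
    ∃ c : V → TriangleCode V, G ∈ codeEvent c ∧
      verticesInTriangles G ≤ 2 * ∑ x, leader (c x) + maxDisjointTriangles G := by
  obtain ⟨U, c, r, tri, T, h, hU⟩ := exists_isTriangleCover G
  refine ⟨c, ⟨r, tri, h.decodes, h.edge_mem, h.sum_weight_le⟩, hU.trans (h.card_le.trans ?_)⟩
  have := (isGreatest_maxDisjointTriangles G).2 ⟨T, h.family, rfl⟩
  omega

/-- By unique decoding the event requires one fixed edge set, of size at least the total weight. -/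
theorem binomialRandom_real_codeEvent_le (p : unitInterval) (c : V → TriangleCode V) :
    (SimpleGraph.binomialRandom V p).real (codeEvent c) ≤ ∏ x, (p : ℝ) ^ weight (c x) := by
  rw [Finset.prod_pow_eq_pow_sum]
  by_cases hc : ∃ r tri, Decodes c r tri ∧ ∑ x, weight (c x) ≤ (edges tri).card
  · obtain ⟨r, tri, hd, hw⟩ := hc
    refine (measureReal_mono ?_).trans ((binomialRandom_real_superset_le p (edges tri)).trans
      (pow_le_pow_of_le_one p.2.1 p.2.2 hw))
    rintro G ⟨r', tri', hd', he, -⟩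
    rw [hd.unique hd']
    exact fun e h ↦ he e h
  · have : codeEvent c = ∅ := by
      ext G
      simp only [codeEvent, Set.mem_ofPred_eq, Set.mem_empty_iff_false, iff_false]
      rintro ⟨r, tri, hd, -, hw⟩
      exact hc ⟨r, tri, hd, hw⟩
    rw [this, measureReal_empty]
    exact pow_nonneg p.2.1 _

/-- Generating function of the code at one vertex; the 9 counts the pairs `(i, j)`. -/
theorem sum_code_weights (θ p : ℝ) :
    ∑ k : TriangleCode V, θ ^ leader k * p ^ weight k
      = 1 + θ * ((Fintype.card V) ^ 2 * p ^ 3 + 9 * Fintype.card V * p ^ 2) := by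
  rw [Fintype.sum_option, Fintype.sum_sum_type]
  simp [leader, weight]
  ring

/-- Graphs with many vertices in triangles but few disjoint triangles are unlikely. -/
theorem binomialRandom_real_le (p : unitInterval) (θ : ℝ) (hθ : 1 ≤ θ) (t : ℝ) :
    (SimpleGraph.binomialRandom V p).real
        {G | 2 * t ≤ (verticesInTriangles G : ℝ) - maxDisjointTriangles G}
      ≤ θ ^ (-t) * (1 + θ * ((Fintype.card V) ^ 2 * (p : ℝ) ^ 3
          + 9 * Fintype.card V * (p : ℝ) ^ 2)) ^ Fintype.card V := by
  classical
  have hθ0 : 0 < θ := by linarith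
  set S : Finset (V → TriangleCode V) :=
    Finset.univ.filter fun c ↦ t ≤ (∑ x, leader (c x) : ℕ) with hS
  have hsub : {G : SimpleGraph V | 2 * t ≤ (verticesInTriangles G : ℝ) - maxDisjointTriangles G}
      ⊆ ⋃ c ∈ S, codeEvent c := by
    intro G hG
    obtain ⟨c, hc, hle⟩ := exists_code G
    have hle' : (verticesInTriangles G : ℝ)
        ≤ 2 * (∑ x, leader (c x) : ℕ) + maxDisjointTriangles G := by exact_mod_cast hle
    have hG' : 2 * t ≤ (verticesInTriangles G : ℝ) - maxDisjointTriangles G := hG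
    simp only [Set.mem_iUnion]
    refine ⟨c, ?_, hc⟩
    rw [hS, Finset.mem_filter]
    exact ⟨Finset.mem_univ _, by linarith⟩
  refine (measureReal_mono hsub (measure_ne_top _ _)).trans ((measureReal_biUnion_finset_le _ _).trans ?_)
  -- Exponential Markov: at least `t` leaders make `θ ^ (leaders - t)` at least 1, after which the
  -- sum may run over all codes.
  have hterm : ∀ c ∈ S, (SimpleGraph.binomialRandom V p).real (codeEvent c)
      ≤ θ ^ (-t) * ∏ x, θ ^ leader (c x) * (p : ℝ) ^ weight (c x) := by
    intro c hc
    refine (binomialRandom_real_codeEvent_le p c).trans ?_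
    rw [Finset.prod_mul_distrib, ← mul_assoc]
    refine le_mul_of_one_le_left (Finset.prod_nonneg fun x _ ↦ pow_nonneg p.2.1 _) ?_
    rw [Finset.prod_pow_eq_pow_sum]
    rw [← Real.rpow_natCast, ← Real.rpow_add hθ0]
    refine Real.one_le_rpow hθ ?_
    have := (Finset.mem_filter.1 hc).2
    linarith
  refine (Finset.sum_le_sum hterm).trans ?_
  rw [← Finset.mul_sum]
  refine mul_le_mul_of_nonneg_left ?_ (by positivity)
  refine (Finset.sum_le_univ_sum_of_nonneg fun c ↦ Finset.prod_nonneg fun x _ ↦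
    mul_nonneg (by positivity) (pow_nonneg p.2.1 _)).trans ?_
  -- Codes at different vertices are chosen freely, so the sum of products factorises.
  rw [← sum_code_weights, ← Finset.card_univ, ← Finset.prod_const, Finset.prod_univ_sum,
    Fintype.piFinset_univ]

/-! ### Planted triangles and the lower bound -/

section Planted
variable {V : Type*} {k r : ℕ} [NeZero k]

/-- The edges of the triangles `{aᵢ, b_{σ i}, c_{τ i}}` together with edges joining every vertex
`dⱼ` to `a₀` and `b_{σ 0}`. -/
def plantedEdges (e : (Fin k ⊕ Fin k ⊕ Fin k ⊕ Fin r) ↪ V)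
    (q : Equiv.Perm (Fin k) × Equiv.Perm (Fin k)) :
    Set (Sym2 V) :=
  Set.range (fun i ↦ s(e (.inl i), e (.inr (.inl (q.1 i))))) ∪
  Set.range (fun i ↦ s(e (.inl i), e (.inr (.inr (.inl (q.2 i)))))) ∪
  Set.range (fun i ↦ s(e (.inr (.inl (q.1 i))), e (.inr (.inr (.inl (q.2 i)))))) ∪
  Set.range (fun j ↦ s(e (.inr (.inr (.inr j))), e (.inl 0))) ∪
  Set.range (fun j ↦ s(e (.inr (.inr (.inr j))), e (.inr (.inl (q.1 0)))))

/-- The graph formed by the planted edges. -/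
def plantedGraph (e : (Fin k ⊕ Fin k ⊕ Fin k ⊕ Fin r) ↪ V)
    (q : Equiv.Perm (Fin k) × Equiv.Perm (Fin k)) :
    SimpleGraph V :=
  SimpleGraph.fromEdgeSet (plantedEdges e q)

/-- The neighbours of `aᵢ` among the `b`s and `c`s reveal `σ i` and `τ i`. This gives `(k!)²`
distinct graphs. -/
theorem plantedGraph_injective (e : (Fin k ⊕ Fin k ⊕ Fin k ⊕ Fin r) ↪ V) :
    Function.Injective (plantedGraph e) := by
  have h1 : ∀ q i j, (plantedGraph e q).Adj (e (.inl i)) (e (.inr (.inl j))) ↔ q.1 i = j := by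
    intro q i j
    simp [plantedGraph, plantedEdges]
  have h2 : ∀ q i j, (plantedGraph e q).Adj (e (.inl i)) (e (.inr (.inr (.inl j)))) ↔ q.2 i = j := by
    intro q i j
    simp [plantedGraph, plantedEdges]
  intro q q' h
  refine Prod.ext (Equiv.ext fun i ↦ ?_) (Equiv.ext fun i ↦ ?_)
  · exact ((h1 q' i _).1 (h ▸ (h1 q i _).2 rfl)).symm
  · exact ((h2 q' i _).1 (h ▸ (h2 q i _).2 rfl)).symm

theorem ncard_edgeSet_plantedGraph_le (e : (Fin k ⊕ Fin k ⊕ Fin k ⊕ Fin r) ↪ V)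
    (q : Equiv.Perm (Fin k) × Equiv.Perm (Fin k)) :
    (plantedGraph e q).edgeSet.ncard ≤ 3 * k + 2 * r := by
  have hr : ∀ {m : ℕ} (f : Fin m → Sym2 V), (Set.range f).ncard ≤ m := by
    intro m f
    rw [← Set.image_univ]
    refine (Set.ncard_image_le (Set.toFinite _)).trans ?_
    simp
  have hle : (plantedGraph e q).edgeSet ⊆ plantedEdges e q := by
    rw [plantedGraph, SimpleGraph.edgeSet_fromEdgeSet]
    exact Set.sdiff_subset
  refine (Set.ncard_le_ncard hle ?_).trans ?_
  · exact ((((Set.finite_range _).union (Set.finite_range _)).union (Set.finite_range _)).union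
      (Set.finite_range _)).union (Set.finite_range _)
  · unfold plantedEdges
    refine (Set.ncard_union_le _ _).trans ?_
    refine (Nat.add_le_add ((Set.ncard_union_le _ _).trans (Nat.add_le_add
      ((Set.ncard_union_le _ _).trans (Nat.add_le_add ((Set.ncard_union_le _ _).trans
        (Nat.add_le_add (hr _) (hr _))) (hr _))) (hr _))) (hr _)).trans ?_
    omega

theorem le_verticesInTriangles_plantedGraph [Fintype V]
    (e : (Fin k ⊕ Fin k ⊕ Fin k ⊕ Fin r) ↪ V)
    (q : Equiv.Perm (Fin k) × Equiv.Perm (Fin k)) :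
    3 * k + r ≤ verticesInTriangles (plantedGraph e q) := by
  classical
  have hcard : (Set.range e).ncard = 3 * k + r := by
    rw [← Set.image_univ, Set.ncard_image_of_injective _ e.injective, Set.ncard_univ]
    simp
    ring
  rw [← hcard, verticesInTriangles]
  refine Set.ncard_le_ncard ?_ (Set.toFinite _)
  have htri : ∀ i, (plantedGraph e q).IsNClique 3
      {e (.inl i), e (.inr (.inl (q.1 i))), e (.inr (.inr (.inl (q.2 i))))} := by
    intro i
    rw [SimpleGraph.is3Clique_triple_iff]
    simp [plantedGraph, plantedEdges]
  have htri' : ∀ j, (plantedGraph e q).IsNClique 3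
      {e (.inl 0), e (.inr (.inl (q.1 0))), e (.inr (.inr (.inr j)))} := by
    intro j
    rw [SimpleGraph.is3Clique_triple_iff]
    simp [plantedGraph, plantedEdges]
  rintro _ ⟨i | i | i | j, rfl⟩
  · exact ⟨_, htri i, by simp⟩
  · exact ⟨_, htri (q.1.symm i), by simp⟩
  · exact ⟨_, htri (q.2.symm i), by simp⟩
  · exact ⟨_, htri' j, by simp⟩

end Planted

/-- A lower bound for the probability of having at least `m` vertices in triangles. -/
theorem le_binomialRandom_real {V : Type*} [Fintype V] (p : unitInterval) (m : ℕ) (hm : 3 ≤ m)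
    (hmV : m ≤ Fintype.card V) :
    ((m / 3).factorial : ℝ) ^ 2 * ((p : ℝ) ^ (m + 2) * (1 - p : ℝ) ^ (Fintype.card V ^ 2))
      ≤ (SimpleGraph.binomialRandom V p).real {G | m ≤ verticesInTriangles G} := by
  classical
  have : NeZero (m / 3) := ⟨by omega⟩
  have hm3 : 3 * (m / 3) + m % 3 = m := Nat.div_add_mod m 3
  obtain ⟨e⟩ : Nonempty ((Fin (m / 3) ⊕ Fin (m / 3) ⊕ Fin (m / 3) ⊕ Fin (m % 3)) ↪ V) := by
    apply Function.Embedding.nonempty_of_card_le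
    simp
    omega
  -- With `k = m / 3` and `r = m % 3 ≤ 2` there are at most `3k + 2r = m + r ≤ m + 2` edges.
  have h := card_mul_le_binomialRandom_real p (Finset.univ.image (plantedGraph e)) (m + 2) (by
    intro G hG
    obtain ⟨q, -, rfl⟩ := Finset.mem_image.1 hG
    have := ncard_edgeSet_plantedGraph_le e q
    omega)
  rw [Finset.card_image_of_injective _ (plantedGraph_injective e), Finset.card_univ,
    Fintype.card_prod, Fintype.card_perm, Fintype.card_fin, Nat.card_eq_fintype_card,
    Nat.cast_mul, ← pow_two] at h
  refine h.trans (measureReal_mono ?_)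
  intro G hG
  rw [Finset.mem_coe] at hG
  obtain ⟨q, -, rfl⟩ := Finset.mem_image.1 hG
  have := le_verticesInTriangles_plantedGraph e q
  rw [hm3] at this
  exact this

/-! ### Asymptotic estimates -/

/-- Crude Stirling: `k^k / k!` is one term of the series for `e^k`. -/
theorem pow_self_mul_exp_neg_le_factorial (k : ℕ) :
    (k : ℝ) ^ k * Real.exp (-k) ≤ k.factorial := by
  have h := Real.pow_div_factorial_le_exp (k : ℝ) (Nat.cast_nonneg k) k
  rw [div_le_iff₀ (by positivity)] at h
  rw [Real.exp_neg, ← div_eq_mul_inv, div_le_iff₀ (Real.exp_pos _)]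
  linarith

/-- Follows from `(1 - p)(1 + 2p) ≥ 1` on this range. -/
theorem exp_neg_two_mul_le_one_sub {p : ℝ} (h0 : 0 ≤ p) (h1 : p ≤ 1 / 2) :
    Real.exp (-(2 * p)) ≤ 1 - p := by
  rw [Real.exp_neg, inv_le_iff_one_le_mul₀ (Real.exp_pos _)]
  have := Real.add_one_le_exp (2 * p)
  nlinarith

instance isProbabilityMeasure_erdosRenyi (lam : ℝ) (n : ℕ) :
    IsProbabilityMeasure (erdosRenyi lam n) :=
  inferInstanceAs (IsProbabilityMeasure (SimpleGraph.binomialRandom _ _))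

/-- The probability that a positive proportion of vertices lies in triangles, from below. -/
theorem exists_exp_le_erdosRenyi_real {lam a : ℝ} (hlam : 0 < lam) (ha0 : 0 < a) (ha1 : a ≤ 1) :
    ∃ C : ℝ, 0 ≤ C ∧ ∀ n : ℕ, 2 * lam ≤ n → 12 ≤ a * n →
      Real.exp (-(a / 3) * n * Real.log n - C * n)
        ≤ (erdosRenyi lam n).real {G | a * (n : ℝ) ≤ (verticesInTriangles G : ℝ)} := by
  -- Chosen so that `k ≥ an/6` reads `log k ≥ log n - D`.
  set D := Real.log (6 / a) with hD
  have hD0 : 0 ≤ D := Real.log_nonneg (by rw [le_div_iff₀ ha0]; linarith)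
  refine ⟨2 * D + 3 * |Real.log lam| + 2 * lam + 7, by positivity, fun n hn1 hn2 ↦ ?_⟩
  have hn12 : (12 : ℝ) ≤ n := hn2.trans (mul_le_of_le_one_left (Nat.cast_nonneg n) ha1)
  have hn0 : (0 : ℝ) < n := by linarith
  set m := ⌈a * (n : ℝ)⌉₊ with hm
  have hm_le : (m : ℝ) ≤ a * n + 1 := (Nat.ceil_lt_add_one (by positivity)).le
  have hle_m : a * n ≤ m := Nat.le_ceil _
  have hmn : m ≤ n := Nat.ceil_le.2 (mul_le_of_le_one_left (Nat.cast_nonneg n) ha1)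
  have hm3 : 3 ≤ m := by
    have : (3 : ℝ) ≤ m := by linarith
    exact_mod_cast this
  set k := m / 3 with hk
  have hkm : (m : ℝ) ≤ 3 * k + 2 := by
    have : m ≤ 3 * k + 2 := by omega
    exact_mod_cast this
  have hkn : (k : ℝ) ≤ n := by
    have : k ≤ n := by omega
    exact_mod_cast this
  have hk6 : a * n / 6 ≤ k := by linarith
  have hk0 : (0 : ℝ) < k := by linarith
  have hp : (edgeProb lam n : ℝ) = lam / n := coe_edgeProb hlam (by linarith)
  have hset : {G : SimpleGraph (Fin n) | a * (n : ℝ) ≤ (verticesInTriangles G : ℝ)}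
      = {G | m ≤ verticesInTriangles G} := by
    ext G
    exact (Nat.ceil_le (a := a * (n : ℝ))).symm
  have key := le_binomialRandom_real (V := Fin n) (edgeProb lam n) m hm3 (by simpa using hmn)
  rw [Fintype.card_fin, hp] at key
  rw [hset, erdosRenyi]
  refine le_trans ?_ key
  have hfac : Real.exp (k * Real.log n - n * D - n) ≤ k.factorial := by
    refine le_trans ?_ (pow_self_mul_exp_neg_le_factorial k)
    have hlogk : Real.log n - D ≤ Real.log k := by
      rw [hD, ← Real.log_div hn0.ne' (by positivity)]
      refine Real.log_le_log (by positivity) (le_trans (le_of_eq ?_) hk6)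
      field_simp
    rw [← Real.rpow_natCast, Real.rpow_def_of_pos hk0, ← Real.exp_add, Real.exp_le_exp]
    nlinarith [mul_le_mul_of_nonneg_left hlogk hk0.le, mul_le_mul_of_nonneg_right hkn hD0]
  have hpow : Real.exp (-(a * n + 3) * Real.log n - 3 * n * |Real.log lam|)
      ≤ (lam / n) ^ (m + 2) := by
    rw [← Real.rpow_natCast, Real.rpow_def_of_pos (by positivity), Real.exp_le_exp,
      Real.log_div hlam.ne' hn0.ne']
    push_cast
    have hlog : 0 ≤ Real.log n := Real.log_nonneg (by linarith)
    have h1 : ((m : ℝ) + 2) * Real.log n ≤ (a * n + 3) * Real.log n :=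
      mul_le_mul_of_nonneg_right (by linarith) hlog
    have hmn' : (m : ℝ) ≤ n := by exact_mod_cast hmn
    have h2 : ((m : ℝ) + 2) * |Real.log lam| ≤ 3 * n * |Real.log lam| :=
      mul_le_mul_of_nonneg_right (by linarith) (abs_nonneg _)
    have h3 : ((m : ℝ) + 2) * (-|Real.log lam|) ≤ ((m : ℝ) + 2) * Real.log lam :=
      mul_le_mul_of_nonneg_left (neg_abs_le _) (by positivity)
    linarith
  have hq : Real.exp (-(2 * lam * n)) ≤ (1 - lam / n) ^ (n ^ 2) := by
    have h := exp_neg_two_mul_le_one_sub (p := lam / n) (by positivity)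
      (by rw [div_le_iff₀ hn0]; linarith)
    refine le_trans (le_of_eq ?_) (pow_le_pow_left₀ (Real.exp_pos _).le h (n ^ 2))
    rw [← Real.exp_nat_mul]
    congr 1
    push_cast
    field_simp
  refine le_trans ?_ (mul_le_mul (pow_le_pow_left₀ (Real.exp_pos _).le hfac 2)
    (mul_le_mul hpow hq (Real.exp_pos _).le (by positivity)) (by positivity) (by positivity))
  -- The leading term is `2(an/3) - an = -an/3` times `log n`. Rounding costs `(13/3) log n ≤ (13/3)
  -- n`, which with the `2n` from the factorials fits into the constant 7.
  rw [← Real.exp_nat_mul, ← Real.exp_add, ← Real.exp_add, Real.exp_le_exp]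
  push_cast
  have hlogn : Real.log n ≤ n := (Real.log_le_sub_one_of_pos hn0).trans (by linarith)
  have hlog : 0 ≤ Real.log n := Real.log_nonneg (by linarith)
  have h4 : (a * n - 2) / 3 * Real.log n ≤ k * Real.log n :=
    mul_le_mul_of_nonneg_right (by linarith) hlog
  linarith

/-! ### The conditional tail bound and the limit -/

/-- Few disjoint triangles together with many vertices in triangles are unlikely. -/
theorem erdosRenyi_real_le {lam a ε : ℝ} (hlam : 0 < lam) {n : ℕ} (hn : 1 ≤ n)
    (hn' : lam ≤ n) :
    (erdosRenyi lam n).real ({G | a * (n : ℝ) ≤ (verticesInTriangles G : ℝ)} ∩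
        {G | (maxDisjointTriangles G : ℝ) ≤ (1 / 3) * (a - ε) * (n : ℝ)})
      ≤ Real.exp (-(a / 3 + ε / 6) * n * Real.log n
          + Real.log (1 + lam ^ 3 + 9 * lam ^ 2) * n) := by
  have hn1 : (1 : ℝ) ≤ n := by exact_mod_cast hn
  have hn0 : (0 : ℝ) < n := by linarith
  -- Taking `θ = n` makes the factor per vertex independent of `n`; the threshold is half of `an -
  -- (a - ε)n/3`.
  have key := binomialRandom_real_le (V := Fin n) (edgeProb lam n) n hn1 ((a / 3 + ε / 6) * n)
  rw [Fintype.card_fin, coe_edgeProb hlam hn'] at key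
  refine (measureReal_mono ?_ (measure_ne_top _ _)).trans (key.trans (le_of_eq ?_))
  · rintro G ⟨hG1, hG2⟩
    simp only [Set.mem_ofPred_eq] at hG1 hG2 ⊢
    linarith
  · have hK : 1 + (n : ℝ) * ((n : ℝ) ^ 2 * (lam / n) ^ 3 + 9 * n * (lam / n) ^ 2)
        = 1 + lam ^ 3 + 9 * lam ^ 2 := by
      field_simp
      ring
    rw [hK, Real.rpow_def_of_pos hn0, Real.exp_add, mul_comm (Real.log _) (n : ℝ),
      Real.exp_nat_mul, Real.exp_log (by positivity)]
    congr 2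
    ring

/-- The tail bound for large `n`, together with positivity of the probability of the conditioning
event. -/
theorem exists_conditionedLaw_real_le {lam a : ℝ} (hlam : 0 < lam) (ha0 : 0 < a) (ha1 : a ≤ 1) :
    ∃ C : ℝ, 0 ≤ C ∧ ∀ n : ℕ, 2 * lam ≤ n → 12 ≤ a * n →
      IsProbabilityMeasure (conditionedLaw lam a n) ∧ ∀ ε : ℝ,
        (conditionedLaw lam a n).real
            {G | (maxDisjointTriangles G : ℝ) ≤ (1 / 3) * (a - ε) * (n : ℝ)}
          ≤ Real.exp (-(1 / 6) * ε * (n : ℝ) * Real.log (n : ℝ) + C * (n : ℝ)) := by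
  obtain ⟨C, hC0, hC⟩ := exists_exp_le_erdosRenyi_real hlam ha0 ha1
  have hK : 0 ≤ Real.log (1 + lam ^ 3 + 9 * lam ^ 2) :=
    Real.log_nonneg (by linarith [pow_pos hlam 3, pow_pos hlam 2])
  refine ⟨C + Real.log (1 + lam ^ 3 + 9 * lam ^ 2), by positivity, fun n hn1 hn2 ↦ ?_⟩
  have hn12 : (12 : ℝ) ≤ n := hn2.trans (mul_le_of_le_one_left (Nat.cast_nonneg n) ha1)
  have hlow := hC n hn1 hn2
  have hpos := (Real.exp_pos _).trans_le hlow
  refine ⟨cond_isProbabilityMeasure fun h0 ↦ hpos.ne' (by rw [measureReal_def, h0]; rfl),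
    fun ε ↦ ?_⟩
  have hup := erdosRenyi_real_le (a := a) (ε := ε) hlam (n := n)
    (by have : (1 : ℝ) ≤ n := by linarith
        exact_mod_cast this) (by linarith)
  rw [conditionedLaw, measureReal_def, cond_apply .of_discrete, ENNReal.toReal_mul,
    ENNReal.toReal_inv, ← measureReal_def, ← measureReal_def, inv_mul_le_iff₀ hpos]
  refine hup.trans (le_trans (le_of_eq ?_)
    (mul_le_mul_of_nonneg_right hlow (Real.exp_pos _).le))
  rw [← Real.exp_add]
  congr 1
  ring

/-- Small `n` is absorbed into the constant uniformly in `ε`: for `ε ≤ a` the added `log B` makes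
the exponent nonnegative, and for `ε > a` the event is empty. -/
theorem conditionedLaw_real_le {lam a : ℝ} (hlam : 0 < lam) (ha0 : 0 < a) (ha1 : a ≤ 1) :
    ∃ C : ℝ, ∀ ε : ℝ, 0 < ε → ∀ n : ℕ, 3 ≤ n →
      (conditionedLaw lam a n).real
          {G | (maxDisjointTriangles G : ℝ) ≤ (1 / 3) * (a - ε) * (n : ℝ)}
        ≤ Real.exp (-(1 / 6) * ε * (n : ℝ) * Real.log (n : ℝ) + C * (n : ℝ)) := by
  obtain ⟨C, hC0, hC⟩ := exists_conditionedLaw_real_le hlam ha0 ha1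
  set B : ℝ := 2 * lam + 12 / a with hB
  have hB1 : 1 ≤ B := by
    have : 1 ≤ 12 / a := by rw [le_div_iff₀ ha0]; linarith
    linarith
  have hlogB := Real.log_nonneg hB1
  refine ⟨C + Real.log B, fun ε hε n hn ↦ ?_⟩
  have hn3 : (3 : ℝ) ≤ n := by exact_mod_cast hn
  rcases le_or_gt B n with hBn | hnB
  · have h12 : 12 / a ≤ n := by linarith
    rw [div_le_iff₀ ha0] at h12
    have h12' : 12 ≤ a * n := by linarith
    have hlam2 : 2 * lam ≤ n := by
      have : 0 ≤ 12 / a := by positivity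
      linarith
    refine ((hC n hlam2 h12').2 ε).trans (Real.exp_le_exp.2 ?_)
    have : 0 ≤ Real.log B * n := by positivity
    linarith
  · rcases le_or_gt ε a with hεa | haε
    · have h1 : (conditionedLaw lam a n).real
          {G | (maxDisjointTriangles G : ℝ) ≤ (1 / 3) * (a - ε) * (n : ℝ)} ≤ 1 := by
        rw [conditionedLaw]
        exact measureReal_le_one
      refine h1.trans (Real.one_le_exp ?_)
      have hlog : Real.log n ≤ Real.log B := Real.log_le_log (by linarith) hnB.le
      have hlog0 : 0 ≤ Real.log n := Real.log_nonneg (by linarith)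
      have h2 : (n : ℝ) * Real.log n ≤ n * Real.log B :=
        mul_le_mul_of_nonneg_left hlog (by linarith)
      have h3 : ε * ((n : ℝ) * Real.log n) ≤ 1 * (n * Real.log n) :=
        mul_le_mul_of_nonneg_right (by linarith) (by positivity)
      have h4 : 0 ≤ (n : ℝ) * Real.log n := by positivity
      have h5 : 0 ≤ C * n := by positivity
      linarith
    · have : {G : SimpleGraph (Fin n) | (maxDisjointTriangles G : ℝ) ≤ (1 / 3) * (a - ε) * (n : ℝ)}
          = ∅ := by
        ext G
        simp only [Set.mem_ofPred_eq, Set.mem_empty_iff_false, iff_false, not_le]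
        refine lt_of_lt_of_le ?_ (Nat.cast_nonneg _)
        nlinarith
      rw [this, measureReal_empty]
      exact (Real.exp_pos _).le

theorem tendsto_conditionedLaw_real {lam a ε : ℝ} (hlam : 0 < lam) (ha0 : 0 < a) (ha1 : a ≤ 1)
    (hε : 0 < ε) :
    Tendsto (fun n : ℕ ↦ (conditionedLaw lam a n).real
      {G | (1 / 3) * (a - ε) * (n : ℝ) ≤ (maxDisjointTriangles G : ℝ)}) atTop (𝓝 1) := by
  obtain ⟨C, -, hC⟩ := exists_conditionedLaw_real_le hlam ha0 ha1
  have hexp : Tendsto (fun n : ℕ ↦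
      Real.exp (-(1 / 6) * ε * (n : ℝ) * Real.log (n : ℝ) + C * (n : ℝ))) atTop (𝓝 0) := by
    refine Real.tendsto_exp_atBot.comp ?_
    have hlog : Tendsto (fun n : ℕ ↦ Real.log (n : ℝ)) atTop atTop :=
      Real.tendsto_log_atTop.comp tendsto_natCast_atTop_atTop
    -- The exponent is `n * (C - (ε/6) log n)`.
    have h := tendsto_natCast_atTop_atTop (R := ℝ).atTop_mul_atBot₀
      (tendsto_atBot_add_const_right _ C
        (hlog.const_mul_atTop_of_neg (show -(1 / 6) * ε < 0 by linarith)))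
    refine h.congr fun n ↦ ?_
    ring
  have hlower : Tendsto (fun n : ℕ ↦
      1 - Real.exp (-(1 / 6) * ε * (n : ℝ) * Real.log (n : ℝ) + C * (n : ℝ))) atTop (𝓝 1) := by
    simpa using hexp.const_sub 1
  have hlarge : ∀ᶠ n : ℕ in atTop, 2 * lam ≤ n ∧ 12 ≤ a * n :=
    (tendsto_natCast_atTop_atTop.eventually_ge_atTop _).and
      ((tendsto_natCast_atTop_atTop.const_mul_atTop ha0).eventually_ge_atTop _)
  refine tendsto_of_tendsto_of_tendsto_of_le_of_le' hlower tendsto_const_nhds ?_ ?_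
  · filter_upwards [hlarge] with n hn
    obtain ⟨hprob, hle⟩ := hC n hn.1 hn.2
    have hcompl := probReal_compl_eq_one_sub (μ := conditionedLaw lam a n)
      (s := {G | (1 / 3) * (a - ε) * (n : ℝ) ≤ (maxDisjointTriangles G : ℝ)}) .of_discrete
    have hmono : (conditionedLaw lam a n).real
          {G | (1 / 3) * (a - ε) * (n : ℝ) ≤ (maxDisjointTriangles G : ℝ)}ᶜ
        ≤ (conditionedLaw lam a n).real
          {G | (maxDisjointTriangles G : ℝ) ≤ (1 / 3) * (a - ε) * (n : ℝ)} :=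
      measureReal_mono fun G hG ↦ by
        rw [Set.mem_compl_iff, Set.mem_ofPred_eq, not_le] at hG
        exact hG.le
    linarith [hle ε]
  · refine Eventually.of_forall fun n ↦ ?_
    rw [conditionedLaw]
    exact measureReal_le_one

end RandomTriangles

theorem theorem2p2 (lam : ℝ) (hlam : 0 < lam) (a : ℝ) (ha0 : 0 < a) (ha1 : a ≤ 1) :
    (∃ C : ℝ, ∀ ε : ℝ, 0 < ε → ∀ n : ℕ, 3 ≤ n → lam ≤ (n : ℝ) →
      (RandomTriangles.conditionedLaw lam a n).real
          {G | (RandomTriangles.maxDisjointTriangles G : ℝ) ≤ (1 / 3) * (a - ε) * (n : ℝ)}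
        ≤ Real.exp (-(1 / 6) * ε * (n : ℝ) * Real.log (n : ℝ) + C * (n : ℝ))) ∧
    (∀ ε : ℝ, 0 < ε →
      Tendsto
        (fun n : ℕ => (RandomTriangles.conditionedLaw lam a n).real
          {G | (1 / 3) * (a - ε) * (n : ℝ) ≤ (RandomTriangles.maxDisjointTriangles G : ℝ)})
        atTop (𝓝 1)) := by
  obtain ⟨C, hC⟩ := RandomTriangles.conditionedLaw_real_le hlam ha0 ha1
  exact ⟨⟨C, fun ε hε n hn _ ↦ hC ε hε n hn⟩,
    fun ε hε ↦ RandomTriangles.tendsto_conditionedLaw_real hlam ha0 ha1 hε⟩
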